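/- Let $\mathbb L^4$ be $\mathbb R^4$ with the Lorentzian metric $\langle\,,\rangle=-dx_0^2+dx_1^2+dx_2^2+dx_3^2$, and let $\Lambda^+=\{v\in\mathbb L^4:\langle v,v\rangle=0,\ v_0>0\}$. Let $M^2$ be a smooth two-dimensional manifold and let $\psi:M^2\to\mathbb L^4$ be a spacelike surface, that is, a smooth immersion whose induced metric $\langle\,,\rangle$ on $M^2$ is Riemannian. Assume that $\psi$ factors through a lightcone, that is, there is $p\in\mathbb L^4$ with $\psi(M^2)\subset p+\Lambda^+$ or $\psi(M^2)\subset p-\Lambda^+$. Let $\nabla$ be the Levi-Civita connection of the induced metric and $\mathrm{II}$ the second fundamental form of $\psi$; for a vector $\xi$ normal to the surface at $q\in M^2$, let $A_\xi:T_qM^2\to T_qM^2$ be the shape operator, $\langle A_\xi v,w\rangle=\langle \mathrm{II}(v,w),\xi\rangle$. Let $\psi_0$ be the first component of $\psi$, let $\nabla\psi_0$ be its gradient, let $\nabla^2\psi_0$ be its Hessian operator, $\nabla^2\psi_0(v)=\nabla_v(\nabla\psi_0)$, and let $\triangle\psi_0=\mathrm{tr}\,\nabla^2\psi_0$ be its Laplacian,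 all with respect to the induced metric. Then $\psi$ is totally umbilical in $\mathbb L^4$ (for every $q\in M^2$ and every vector $\xi$ normal at $q$, $A_\xi$ is a multiple of the identity) if and only if $$\nabla^2\psi_0=\tfrac12\,\triangle\psi_0\,I\quad\text{on } M^2.$$ -/

import Mathlib

open scoped Manifold ContDiff Bundle

noncomputable section

/-- The underlying vector space `ℝ⁴` of Lorentz-Minkowski spacetime `𝕃⁴`. -/
abbrev MinkowskiSpace : Type := Fin 4 → ℝ

/-- The Lorentzian metric `-dx₀² + dx₁² + dx₂² + dx₃²` of `𝕃⁴`. -/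
def minkowski : LinearMap.BilinForm ℝ MinkowskiSpace :=
  LinearMap.mk₂ ℝ (fun v w ↦ -(v 0 * w 0) + v 1 * w 1 + v 2 * w 2 + v 3 * w 3)
    (fun _ _ _ ↦ by simp only [Pi.add_apply]; ring)
    (fun _ _ _ ↦ by simp only [Pi.smul_apply, smul_eq_mul]; ring)
    (fun _ _ _ ↦ by simp only [Pi.add_apply]; ring)
    (fun _ _ _ ↦ by simp only [Pi.smul_apply, smul_eq_mul]; ring)

theorem minkowski_symm (v w : MinkowskiSpace) : minkowski v w = minkowski w v := by
  simp only [minkowski, LinearMap.mk₂_apply]; ring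

/-- The future lightcone `Λ⁺` at the origin. -/
def futureLightcone : Set MinkowskiSpace := {v | minkowski v v = 0 ∧ 0 < v 0}

/-- A spacelike surface: a smooth map `ψ : M² → 𝕃⁴` whose induced metric is Riemannian, that is,
positive definite. Positive definiteness makes `dψ` injective, so `ψ` is an immersion. -/
structure SpacelikeSurface (M : Type*) [TopologicalSpace M]
    [ChartedSpace (EuclideanSpace ℝ (Fin 2)) M] where
  toFun : M → MinkowskiSpace
  smooth : ContMDiff (𝓡 2) 𝓘(ℝ, MinkowskiSpace) ∞ toFun
  spacelike : ∀ (x : M) (v : TangentSpace (𝓡 2) x), v ≠ 0 →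
    0 < minkowski (mvfderiv (𝓡 2) toFun x v) (mvfderiv (𝓡 2) toFun x v)

namespace SpacelikeSurface

variable {M : Type*} [TopologicalSpace M] [ChartedSpace (EuclideanSpace ℝ (Fin 2)) M]

instance : CoeFun (SpacelikeSurface M) fun _ ↦ M → MinkowskiSpace := ⟨toFun⟩

instance tangentSpace_finiteDimensional (x : M) : FiniteDimensional ℝ (TangentSpace (𝓡 2) x) :=
  inferInstanceAs (FiniteDimensional ℝ (EuclideanSpace ℝ (Fin 2)))

/-- The differential `ψ_* : T_x M → 𝕃⁴`. -/
def differential (ψ : SpacelikeSurface M) (x : M) : TangentSpace (𝓡 2) x →L[ℝ] MinkowskiSpace :=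
  mvfderiv (𝓡 2) ψ x

/-- The induced metric `⟨v, w⟩ = ⟨ψ_* v, ψ_* w⟩` on `T_x M`. -/
def metric (ψ : SpacelikeSurface M) (x : M) : LinearMap.BilinForm ℝ (TangentSpace (𝓡 2) x) :=
  minkowski.compl₁₂ (ψ.differential x : TangentSpace (𝓡 2) x →ₗ[ℝ] MinkowskiSpace)
    (ψ.differential x : TangentSpace (𝓡 2) x →ₗ[ℝ] MinkowskiSpace)

theorem metric_apply (ψ : SpacelikeSurface M) (x : M) (v w : TangentSpace (𝓡 2) x) :
    ψ.metric x v w = minkowski (ψ.differential x v) (ψ.differential x w) := rfl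

theorem metric_nondegenerate (ψ : SpacelikeSurface M) (x : M) : (ψ.metric x).Nondegenerate := by
  constructor
  · intro v hv
    by_contra h
    exact (ψ.spacelike x v h).ne' (hv v)
  · intro v hv
    by_contra h
    exact (ψ.spacelike x v h).ne' (hv v)

/-- The vector of `T_x M` that represents a linear form through the induced metric. -/
def sharp (ψ : SpacelikeSurface M) (x : M) :
    Module.Dual ℝ (TangentSpace (𝓡 2) x) ≃ₗ[ℝ] TangentSpace (𝓡 2) x :=
  ((ψ.metric x).toDual (ψ.metric_nondegenerate x)).symm

theorem metric_sharp (ψ : SpacelikeSurface M) (x : M)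
    (α : Module.Dual ℝ (TangentSpace (𝓡 2) x)) (w : TangentSpace (𝓡 2) x) :
    ψ.metric x (ψ.sharp x α) w = α w :=
  LinearMap.BilinForm.apply_toDual_symm_apply α w

/-- The vector field `ψ_* Y` along `ψ`. -/
def pushforward (ψ : SpacelikeSurface M) (Y : Π x : M, TangentSpace (𝓡 2) x) (x : M) :
    MinkowskiSpace :=
  ψ.differential x (Y x)

theorem pushforward_add (ψ : SpacelikeSurface M) (Y Z : Π x : M, TangentSpace (𝓡 2) x) :
    ψ.pushforward (Y + Z) = ψ.pushforward Y + ψ.pushforward Z := by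
  ext1 x
  exact map_add (ψ.differential x) _ _

theorem pushforward_smul (ψ : SpacelikeSurface M) (f : M → ℝ) (Y : Π x : M, TangentSpace (𝓡 2) x) :
    ψ.pushforward (f • Y) = f • ψ.pushforward Y := by
  ext1 x
  exact map_smul (ψ.differential x) _ _

/-- The tangential component of a vector of `𝕃⁴` at a point of the surface. -/
def tangentialPart (ψ : SpacelikeSurface M) (x : M) :
    MinkowskiSpace →L[ℝ] TangentSpace (𝓡 2) x :=
  LinearMap.toContinuousLinearMap ((ψ.sharp x).toLinearMap ∘ₗ
    (minkowski.compl₁₂ LinearMap.id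
      (ψ.differential x : TangentSpace (𝓡 2) x →ₗ[ℝ] MinkowskiSpace)))

theorem metric_tangentialPart (ψ : SpacelikeSurface M) (x : M) (u : MinkowskiSpace)
    (w : TangentSpace (𝓡 2) x) :
    ψ.metric x (ψ.tangentialPart x u) w = minkowski u (ψ.differential x w) :=
  ψ.metric_sharp x _ w

theorem tangentialPart_differential (ψ : SpacelikeSurface M) (x : M) (v : TangentSpace (𝓡 2) x) :
    ψ.tangentialPart x (ψ.differential x v) = v := by
  refine sub_eq_zero.mp ((ψ.metric_nondegenerate x).1 _ fun w ↦ ?_)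
  rw [map_sub, LinearMap.sub_apply, metric_tangentialPart, metric_apply, sub_self]

theorem mvfderiv_minkowski {F G : M → MinkowskiSpace} {x : M}
    (hF : MDifferentiableAt (𝓡 2) 𝓘(ℝ, MinkowskiSpace) F x)
    (hG : MDifferentiableAt (𝓡 2) 𝓘(ℝ, MinkowskiSpace) G x) (v : TangentSpace (𝓡 2) x) :
    mvfderiv (𝓡 2) (fun y ↦ minkowski (F y) (G y)) x v =
      minkowski (mvfderiv (𝓡 2) F x v) (G x) + minkowski (F x) (mvfderiv (𝓡 2) G x v) := by
  let B : MinkowskiSpace →L[ℝ] MinkowskiSpace →L[ℝ] ℝ := minkowski.toContinuousBilinearMap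
  have hFG : HasMFDerivAt (𝓡 2) 𝓘(ℝ, MinkowskiSpace × MinkowskiSpace) (fun y ↦ (F y, G y)) x
      ((mvfderiv (𝓡 2) F x).prod (mvfderiv (𝓡 2) G x)) :=
    ⟨hF.continuousAt.prodMk hG.continuousAt, hF.hasMFDerivAt.2.prodMk hG.hasMFDerivAt.2⟩
  have h := HasMFDerivAt.comp x (B.isBoundedBilinearMap.hasFDerivAt (F x, G x)).hasMFDerivAt hFG
  have h2 := congrArg (fun L ↦ L v) h.mfderiv
  refine h2.trans ?_
  exact add_comm _ _

variable [IsManifold (𝓡 2) ∞ M]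

/-- The vector field `Y` is differentiable at `x`, as a section of the tangent bundle. -/
abbrev DifferentiableFieldAt (Y : Π x : M, TangentSpace (𝓡 2) x) (x : M) : Prop :=
  MDifferentiableAt (𝓡 2) ((𝓡 2).prod 𝓘(ℝ, EuclideanSpace ℝ (Fin 2)))
    (fun y ↦ Bundle.TotalSpace.mk' (EuclideanSpace ℝ (Fin 2)) y (Y y)) x

/-- `∇` is the Levi-Civita connection of the induced metric: it is torsion-free and
`X⟨Y, Z⟩ = ⟨∇_X Y, Z⟩ + ⟨Y, ∇_X Z⟩`. -/
structure IsLeviCivita (ψ : SpacelikeSurface M)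
    (cov : CovariantDerivative (𝓡 2) (EuclideanSpace ℝ (Fin 2))
      (TangentSpace (𝓡 2) : M → Type _)) : Prop where
  torsion_eq_zero : cov.torsion = 0
  metric_compatible : ∀ (x : M) (Y Z : Π x : M, TangentSpace (𝓡 2) x),
    DifferentiableFieldAt Y x → DifferentiableFieldAt Z x → ∀ v : TangentSpace (𝓡 2) x,
      mvfderiv (𝓡 2) (fun y ↦ ψ.metric y (Y y) (Z y)) x v =
        ψ.metric x (cov Y x v) (Z x) + ψ.metric x (Y x) (cov Z x v)

theorem mdifferentiableAt_pushforward (ψ : SpacelikeSurface M) {Y : Π x : M, TangentSpace (𝓡 2) x}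
    {x : M} (hY : DifferentiableFieldAt Y x) :
    MDifferentiableAt (𝓡 2) 𝓘(ℝ, MinkowskiSpace) (ψ.pushforward Y) x := by
  have h1 : ContMDiff (𝓡 2).tangent 𝓘(ℝ, MinkowskiSpace).tangent 1
      (tangentMap (𝓡 2) 𝓘(ℝ, MinkowskiSpace) ψ) :=
    ψ.smooth.contMDiff_tangentMap (by rw [one_add_one_eq_two]; exact ENat.LEInfty.out)
  have h2 := (contMDiff_snd_tangentBundle_modelSpace (n := 1) MinkowskiSpace
    𝓘(ℝ, MinkowskiSpace)).comp h1
  exact MDifferentiableAt.comp (g := (fun p : TangentBundle 𝓘(ℝ, MinkowskiSpace) MinkowskiSpace ↦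
    (p.2 : MinkowskiSpace)) ∘ tangentMap (𝓡 2) 𝓘(ℝ, MinkowskiSpace) ψ) x
    (h2.mdifferentiable one_ne_zero _) hY

/-- The tangential component of the flat connection of `𝕃⁴`. -/
def tangentialConnection (ψ : SpacelikeSurface M) :
    CovariantDerivative (𝓡 2) (EuclideanSpace ℝ (Fin 2)) (TangentSpace (𝓡 2) : M → Type _) where
  toFun Y x := ψ.tangentialPart x ∘L mvfderiv (𝓡 2) (ψ.pushforward Y) x
  isCovariantDerivativeOnUniv :=
    { add := fun {Y Z x} hY hZ _ ↦ by
        rw [pushforward_add, mvfderiv_add (ψ.mdifferentiableAt_pushforward hY)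
          (ψ.mdifferentiableAt_pushforward hZ), ContinuousLinearMap.comp_add]
      leibniz := fun {Y f x} hY hf _ ↦ by
        rw [pushforward_smul, mvfderiv_smul hf (ψ.mdifferentiableAt_pushforward hY)]
        ext1 v
        simp [pushforward, tangentialPart_differential] }

/-- The chain rule in the chart at `x`. -/
theorem mvfderiv_comp_extChartAt_symm {F : M → MinkowskiSpace} (x : M)
    {z : EuclideanSpace ℝ (Fin 2)} (hz : z ∈ (extChartAt (𝓡 2) x).target)
    (hF : MDifferentiableAt (𝓡 2) 𝓘(ℝ, MinkowskiSpace) F ((extChartAt (𝓡 2) x).symm z))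
    (u : EuclideanSpace ℝ (Fin 2)) :
    mvfderiv (𝓡 2) F ((extChartAt (𝓡 2) x).symm z)
      (mfderivWithin 𝓘(ℝ, EuclideanSpace ℝ (Fin 2)) (𝓡 2) (extChartAt (𝓡 2) x).symm
        (Set.range (𝓡 2)) z u) =
      fderiv ℝ (F ∘ (extChartAt (𝓡 2) x).symm) z u := by
  have h1 := (mdifferentiableWithinAt_extChartAt_symm (I := 𝓡 2) hz)
  have h2 := (hF.hasMFDerivAt.comp_hasMFDerivWithinAt z h1.hasMFDerivWithinAt)
  have h3 := (h2.hasMFDerivAt (by simp)).mfderiv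
  rw [mfderiv_eq_fderiv] at h3
  exact (congrArg (fun L ↦ L u) h3).symm

theorem differential_mlieBracket (ψ : SpacelikeSurface M) {X Y : Π x : M, TangentSpace (𝓡 2) x}
    {x : M} (hX : DifferentiableFieldAt X x) (hY : DifferentiableFieldAt Y x) :
    ψ.differential x (VectorField.mlieBracket (𝓡 2) X Y x) =
      mvfderiv (𝓡 2) (ψ.pushforward Y) x (X x) - mvfderiv (𝓡 2) (ψ.pushforward X) x (Y x) := by
  set φ := extChartAt (𝓡 2) x with hφ
  let f : EuclideanSpace ℝ (Fin 2) → MinkowskiSpace := ψ ∘ φ.symm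
  have hpt : φ x ∈ φ.target := mem_extChartAt_target x
  have hinv : φ.symm (φ x) = x := extChartAt_to_inv x
  let pb (Z : Π x : M, TangentSpace (𝓡 2) x) :
      EuclideanSpace ℝ (Fin 2) → EuclideanSpace ℝ (Fin 2) :=
    VectorField.mpullbackWithin 𝓘(ℝ, EuclideanSpace ℝ (Fin 2)) (𝓡 2) φ.symm Z (Set.range (𝓡 2))
  have hψ : MDifferentiable (𝓡 2) 𝓘(ℝ, MinkowskiSpace) ψ :=
    ψ.smooth.mdifferentiable (by simp)
  have hpb (Z : Π x : M, TangentSpace (𝓡 2) x) {z} (hz : z ∈ φ.target) :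
      mfderivWithin 𝓘(ℝ, EuclideanSpace ℝ (Fin 2)) (𝓡 2) φ.symm (Set.range (𝓡 2)) z (pb Z z) =
        Z (φ.symm z) :=
    (isInvertible_mfderivWithin_extChartAt_symm hz).self_apply_inverse _
  have hpbd (Z : Π x : M, TangentSpace (𝓡 2) x) (hZ : DifferentiableFieldAt Z x) :
      DifferentiableAt ℝ (pb Z) (φ x) := by
    have := MDifferentiableWithinAt.differentiableWithinAt_mpullbackWithin_vectorField
      (s := Set.univ) (MDifferentiableAt.mdifferentiableWithinAt hZ)
    exact this.differentiableAt (by simp)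
  have hpush (Z : Π x : M, TangentSpace (𝓡 2) x) {z} (hz : z ∈ φ.target) :
      (ψ.pushforward Z ∘ φ.symm) z = fderiv ℝ f z (pb Z z) := by
    have := mvfderiv_comp_extChartAt_symm x hz (hψ (φ.symm z)) (pb Z z)
    rw [← this]
    exact congrArg (ψ.differential (φ.symm z)) (hpb Z hz).symm
  have hf : ContDiffAt ℝ 2 f (φ x) := by
    have h1 : ContMDiffAt 𝓘(ℝ, EuclideanSpace ℝ (Fin 2)) (𝓡 2) 2 φ.symm (φ x) := by
      have := contMDiffWithinAt_extChartAt_symm_range (I := 𝓡 2) (n := 2) x hpt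
      exact this.contMDiffAt (by simp)
    exact ((ψ.smooth.of_le ENat.LEInfty.out).contMDiffAt.comp (φ x) h1).contDiffAt
  have hfd : DifferentiableAt ℝ (fderiv ℝ f) (φ x) :=
    (hf.fderiv_right (m := 1) le_rfl).differentiableAt one_ne_zero
  have hopen : φ.target ∈ nhds (φ x) := extChartAt_target_mem_nhds x
  have hder (Z W : Π x : M, TangentSpace (𝓡 2) x) (hZ : DifferentiableFieldAt Z x) :
      mvfderiv (𝓡 2) (ψ.pushforward Z) x (W x) =
        fderiv ℝ (fderiv ℝ f) (φ x) (pb W (φ x)) (pb Z (φ x)) +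
          fderiv ℝ f (φ x) (fderiv ℝ (pb Z) (φ x) (pb W (φ x))) := by
    have h1 := mvfderiv_comp_extChartAt_symm (F := ψ.pushforward Z) x hpt
      (by rw [hinv]; exact ψ.mdifferentiableAt_pushforward hZ) (pb W (φ x))
    have h2 : ψ.pushforward Z ∘ φ.symm =ᶠ[nhds (φ x)] fun z ↦ fderiv ℝ f z (pb Z z) :=
      Filter.eventually_of_mem hopen fun z hz ↦ hpush Z hz
    rw [h2.fderiv_eq, fderiv_clm_apply hfd (hpbd Z hZ)] at h1
    have h3 : mvfderiv (𝓡 2) (ψ.pushforward Z) (φ.symm (φ x)) (W (φ.symm (φ x))) =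
        mvfderiv (𝓡 2) (ψ.pushforward Z) x (W x) := by rw [hinv]
    rw [← h3, ← hpb W hpt]
    refine h1.trans ?_
    simp [add_comm]
  have hsymm := (hf.isSymmSndFDerivAt (by simp)) (pb X (φ x)) (pb Y (φ x))
  have hbr : ψ.differential x (VectorField.mlieBracket (𝓡 2) X Y x) =
      fderiv ℝ f (φ x) (VectorField.lieBracket ℝ (pb X) (pb Y) (φ x)) := by
    have h1 : HasMFDerivAt (𝓡 2) 𝓘(ℝ, MinkowskiSpace) (f ∘ φ) x
        ((fderiv ℝ f (φ x)).comp (mfderiv (𝓡 2) 𝓘(ℝ, EuclideanSpace ℝ (Fin 2)) φ x)) :=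
      HasMFDerivAt.comp x (hf.differentiableAt two_ne_zero).hasFDerivAt.hasMFDerivAt
        (mdifferentiableAt_extChartAt (mem_chart_source _ x)).hasMFDerivAt
    have h2 : f ∘ φ =ᶠ[nhds x] ψ :=
      Filter.eventually_of_mem (extChartAt_source_mem_nhds x) fun y hy ↦
        congrArg ψ (φ.left_inv hy)
    have h3 := (h1.congr_of_eventuallyEq h2.symm).mfderiv
    have h4 := congrArg (fun L ↦ L (VectorField.mlieBracket (𝓡 2) X Y x)) h3
    refine h4.trans (congrArg (fderiv ℝ f (φ x)) ?_)
    have h5 := (isInvertible_mfderiv_extChartAt (I := 𝓡 2)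
      (mem_extChartAt_source x)).self_apply_inverse
      (VectorField.lieBracket ℝ (pb X) (pb Y) (φ x))
    have h6 : VectorField.mlieBracket (𝓡 2) X Y x =
        (mfderiv (𝓡 2) 𝓘(ℝ, EuclideanSpace ℝ (Fin 2)) (extChartAt (𝓡 2) x) x).inverse
          (VectorField.lieBracket ℝ (pb X) (pb Y) (φ x)) := by
      rw [← VectorField.mlieBracketWithin_univ, VectorField.mlieBracketWithin_apply]
      have h7 : VectorField.lieBracketWithin ℝ (pb X) (pb Y)
          (φ.symm ⁻¹' Set.univ ∩ Set.range (𝓡 2)) (φ x) =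
          VectorField.lieBracket ℝ (pb X) (pb Y) (φ x) := by
        rw [Set.preimage_univ, Set.univ_inter, ModelWithCorners.range_eq_univ,
          VectorField.lieBracketWithin_univ]
      exact congrArg (mfderiv (𝓡 2) 𝓘(ℝ, EuclideanSpace ℝ (Fin 2)) (extChartAt (𝓡 2) x) x).inverse
        h7
    exact (congrArg (mfderiv (𝓡 2) 𝓘(ℝ, EuclideanSpace ℝ (Fin 2)) (extChartAt (𝓡 2) x) x) h6).trans
      h5
  rw [hbr, hder Y X hY, hder X Y hX, hsymm, VectorField.lieBracket, map_sub]
  abel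

theorem exists_isLeviCivita (ψ : SpacelikeSurface M) : ∃ cov, ψ.IsLeviCivita cov := by
  refine ⟨ψ.tangentialConnection, ?_, fun x Y Z hY hZ v ↦ ?_⟩
  · rw [CovariantDerivative.torsion_eq_zero_iff]
    intro X Y x hX hY
    rw [← ψ.tangentialPart_differential x (VectorField.mlieBracket (𝓡 2) X Y x),
      ψ.differential_mlieBracket hX hY, map_sub]
    rfl
  · change mvfderiv (𝓡 2) (fun y ↦ minkowski (ψ.pushforward Y y) (ψ.pushforward Z y)) x v = _
    rw [mvfderiv_minkowski (ψ.mdifferentiableAt_pushforward hY)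
      (ψ.mdifferentiableAt_pushforward hZ)]
    congr 1
    · exact (ψ.metric_tangentialPart x _ _).symm
    · rw [minkowski_symm, metric_apply, minkowski_symm (ψ.differential x (Y x))]
      exact (ψ.metric_tangentialPart x _ _).symm

/-- The Levi-Civita connection `∇` of the induced metric. -/
def leviCivita (ψ : SpacelikeSurface M) :
    CovariantDerivative (𝓡 2) (EuclideanSpace ℝ (Fin 2)) (TangentSpace (𝓡 2) : M → Type _) :=
  ψ.exists_isLeviCivita.choose

theorem isLeviCivita_leviCivita (ψ : SpacelikeSurface M) : ψ.IsLeviCivita ψ.leviCivita :=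
  ψ.exists_isLeviCivita.choose_spec

/-- `D_X(ψ_* Y) - ψ_*(∇_X Y)` at `x`, as a linear map in the value of `X` at `x`. -/
def gaussDefect (ψ : SpacelikeSurface M) (Y : Π x : M, TangentSpace (𝓡 2) x) (x : M) :
    TangentSpace (𝓡 2) x →L[ℝ] MinkowskiSpace :=
  mvfderiv (𝓡 2) (ψ.pushforward Y) x - ψ.differential x ∘L ψ.leviCivita Y x

theorem tensorialAt_gaussDefect (ψ : SpacelikeSurface M) (x : M) :
    TensorialAt (𝓡 2) (EuclideanSpace ℝ (Fin 2)) (ψ.gaussDefect · x) x where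
  smul hf hY := by
    rw [gaussDefect, gaussDefect, pushforward_smul,
      mvfderiv_smul hf (ψ.mdifferentiableAt_pushforward hY),
      ψ.leviCivita.isCovariantDerivativeOnUniv.leibniz hY hf]
    ext1 v
    simp [pushforward, smul_sub]
  add hY hZ := by
    rw [gaussDefect, gaussDefect, gaussDefect, pushforward_add,
      mvfderiv_add (ψ.mdifferentiableAt_pushforward hY) (ψ.mdifferentiableAt_pushforward hZ),
      ψ.leviCivita.isCovariantDerivativeOnUniv.add hY hZ]
    ext1 v
    simp
    abel

/-- The second fundamental form: by the Gauss formula,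
`II(X, Y) = D_X(ψ_* Y) - ψ_*(∇_X Y)`, with `D` the flat connection of `𝕃⁴`. -/
def secondFundamentalForm (ψ : SpacelikeSurface M) (x : M) :
    TangentSpace (𝓡 2) x →ₗ[ℝ] TangentSpace (𝓡 2) x →ₗ[ℝ] MinkowskiSpace :=
  LinearMap.mk₂ ℝ
    (fun v w ↦ TensorialAt.mkHom (ψ.gaussDefect · x) x (ψ.tensorialAt_gaussDefect x) w v)
    (fun _ _ _ ↦ map_add _ _ _) (fun _ _ _ ↦ map_smul _ _ _)
    (fun _ _ _ ↦ by rw [map_add, add_apply])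
    (fun _ _ _ ↦ by rw [map_smul, smul_apply])

theorem secondFundamentalForm_apply (ψ : SpacelikeSurface M) {X Y : Π x : M, TangentSpace (𝓡 2) x}
    {x : M} (hY : DifferentiableFieldAt Y x) :
    ψ.secondFundamentalForm x (X x) (Y x) =
      mvfderiv (𝓡 2) (ψ.pushforward Y) x (X x) - ψ.differential x (ψ.leviCivita Y x (X x)) := by
  rw [secondFundamentalForm, LinearMap.mk₂_apply, TensorialAt.mkHom_apply _ hY]
  rfl

/-- `ξ` is normal to the surface at `x`. -/
def IsNormalAt (ψ : SpacelikeSurface M) (x : M) (ξ : MinkowskiSpace) : Prop :=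
  ∀ v : TangentSpace (𝓡 2) x, minkowski ξ (ψ.differential x v) = 0

/-- The shape operator `A_ξ`, given by `⟨A_ξ v, w⟩ = ⟨II(v, w), ξ⟩`. -/
def shapeOperator (ψ : SpacelikeSurface M) (x : M) (ξ : MinkowskiSpace) :
    Module.End ℝ (TangentSpace (𝓡 2) x) where
  toFun v := ψ.sharp x (minkowski.flip ξ ∘ₗ ψ.secondFundamentalForm x v)
  map_add' v w := by
    rw [← map_add]
    congr 1
    ext u
    simp
  map_smul' c v := by
    rw [← map_smul]
    congr 1
    ext u
    simp

theorem metric_shapeOperator (ψ : SpacelikeSurface M) (x : M) (ξ : MinkowskiSpace)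
    (v w : TangentSpace (𝓡 2) x) :
    ψ.metric x (ψ.shapeOperator x ξ v) w = minkowski (ψ.secondFundamentalForm x v w) ξ :=
  ψ.metric_sharp x _ w

/-- The surface is totally umbilical: at every point, the shape operator of every normal vector is
a multiple of the identity. -/
def IsTotallyUmbilical (ψ : SpacelikeSurface M) : Prop :=
  ∀ (x : M) (ξ : MinkowskiSpace), ψ.IsNormalAt x ξ →
    ∃ c : ℝ, ψ.shapeOperator x ξ = c • LinearMap.id

/-- The gradient `∇f` for the induced metric: `⟨∇f, w⟩ = df(w)`. -/
def gradient (ψ : SpacelikeSurface M) (f : M → ℝ) (x : M) : TangentSpace (𝓡 2) x :=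
  ψ.sharp x (mvfderiv (𝓡 2) f x : TangentSpace (𝓡 2) x →ₗ[ℝ] ℝ)

/-- The Hessian operator `∇²f(v) = ∇_v(∇f)`. -/
def hessian (ψ : SpacelikeSurface M) (f : M → ℝ) (x : M) :
    Module.End ℝ (TangentSpace (𝓡 2) x) :=
  (ψ.leviCivita (ψ.gradient f) x : TangentSpace (𝓡 2) x →ₗ[ℝ] TangentSpace (𝓡 2) x)

/-- The Laplacian `Δf`, the trace of the Hessian operator. -/
def laplacian (ψ : SpacelikeSurface M) (f : M → ℝ) (x : M) : ℝ :=
  LinearMap.trace ℝ (TangentSpace (𝓡 2) x) (ψ.hessian f x)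

/-- `ψ` factors through a lightcone: its image lies in the future lightcone `p + Λ⁺` or in the past
lightcone `p - Λ⁺` at some `p`. -/
def FactorsThroughLightcone (ψ : SpacelikeSurface M) : Prop :=
  ∃ p : MinkowskiSpace,
    (∀ x, ψ x - p ∈ futureLightcone) ∨ (∀ x, p - ψ x ∈ futureLightcone)

end SpacelikeSurface

end

/-! ### Lorentzian linear algebra of the tangent and normal planes -/

namespace SpacelikeSurface

open FiberBundle

/-! Two normal fields control every shape operator. The position vector `ξ = ψ - p` is null:
differentiating `⟨ξ, ξ⟩ = 0` shows that it is normal, and differentiating `⟨ξ, ψ_* Y⟩ = 0` gives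
`A_ξ = -I` (`shapeOperator_position`). The other is `ν`, the normal part of `-e₀`. Since `ψ₀ = ⟨ψ,
-e₀⟩`, the Hessian of `ψ₀` is exactly `A_ν` (`hessian_eq_shapeOperator`).

The lightcone gives `⟨ξ, ν⟩ = (ψ - p)₀ ≠ 0`, so `ξ` and `ν` span the two-dimensional normal plane
(`IsNormalAt.exists_eq_add_of_null`). As `A` is linear in the normal vector, total umbilicity
amounts to `A_ν = ∇²ψ₀` being a multiple of the identity; in dimension two the factor must be half
the trace.

The Levi-Civita connection is known here only through its two axioms, so the normality of `II` is
derived from them (`isNormalAt_secondFundamentalForm`). -/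

theorem minkowski_nondegenerate : minkowski.Nondegenerate := by
  have h : ∀ v : MinkowskiSpace, (∀ w, minkowski v w = 0) → v = 0 := by
    intro v hv
    ext i
    have hi := hv (Pi.single i 1)
    fin_cases i <;> simpa [minkowski, Pi.single_apply] using hi
  exact ⟨h, fun v hv ↦ h v fun w ↦ by rw [minkowski_symm]; exact hv w⟩

/-- The vector `-e₀`, which represents the first coordinate: `⟨u, -e₀⟩ = u₀`. -/
noncomputable def timeVector : MinkowskiSpace := Pi.single 0 (-1)

theorem minkowski_timeVector (u : MinkowskiSpace) : minkowski u timeVector = u 0 := by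
  simp [minkowski, timeVector]

variable {M : Type*} [TopologicalSpace M] [ChartedSpace (EuclideanSpace ℝ (Fin 2)) M]

theorem finrank_tangentSpace (x : M) : Module.finrank ℝ (TangentSpace (𝓡 2) x) = 2 :=
  finrank_euclideanSpace_fin (𝕜 := ℝ) (n := 2)

theorem mdifferentiableAt_minkowski {F G : M → MinkowskiSpace} {x : M}
    (hF : MDifferentiableAt (𝓡 2) 𝓘(ℝ, MinkowskiSpace) F x)
    (hG : MDifferentiableAt (𝓡 2) 𝓘(ℝ, MinkowskiSpace) G x) :
    MDifferentiableAt (𝓡 2) 𝓘(ℝ, ℝ) (fun y ↦ minkowski (F y) (G y)) x := by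
  let B : MinkowskiSpace →L[ℝ] MinkowskiSpace →L[ℝ] ℝ := minkowski.toContinuousBilinearMap
  exact DifferentiableAt.comp_mdifferentiableAt (f := fun y ↦ (F y, G y))
    (B.isBoundedBilinearMap.differentiableAt (F x, G x)) (hF.prodMk_space hG)

theorem mdifferentiable (ψ : SpacelikeSurface M) :
    MDifferentiable (𝓡 2) 𝓘(ℝ, MinkowskiSpace) ψ :=
  ψ.smooth.mdifferentiable (by simp)

theorem mvfderiv_apply_zero {F : M → MinkowskiSpace} {x : M}
    (hF : MDifferentiableAt (𝓡 2) 𝓘(ℝ, MinkowskiSpace) F x) (v : TangentSpace (𝓡 2) x) :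
    mvfderiv (𝓡 2) (fun y ↦ F y 0) x v = mvfderiv (𝓡 2) F x v 0 := by
  have h := mvfderiv_minkowski hF (mdifferentiableAt_const (c := timeVector)) v
  simpa [minkowski_timeVector, mvfderiv_const] using h

theorem metric_gradient (ψ : SpacelikeSurface M) (f : M → ℝ) (x : M)
    (w : TangentSpace (𝓡 2) x) :
    ψ.metric x (ψ.gradient f x) w = mvfderiv (𝓡 2) f x w :=
  ψ.metric_sharp x _ w

theorem differential_injective (ψ : SpacelikeSurface M) (x : M) :
    Function.Injective (ψ.differential x) :=
  Function.LeftInverse.injective (ψ.tangentialPart_differential x)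

/-- The normal component of a vector of `𝕃⁴` at a point of the surface. -/
noncomputable def normalPart (ψ : SpacelikeSurface M) (x : M) (u : MinkowskiSpace) : MinkowskiSpace :=
  u - ψ.differential x (ψ.tangentialPart x u)

theorem isNormalAt_normalPart (ψ : SpacelikeSurface M) (x : M) (u : MinkowskiSpace) :
    ψ.IsNormalAt x (ψ.normalPart x u) := by
  intro v
  rw [normalPart, map_sub, LinearMap.sub_apply, ← ψ.metric_apply, ψ.metric_tangentialPart, sub_self]

/-- A normal vector does not see tangential components. This allows `ν` to be replaced by the
constant vector `-e₀` in pairings. -/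
theorem IsNormalAt.minkowski_normalPart {ψ : SpacelikeSurface M} {x : M} {ξ : MinkowskiSpace}
    (hξ : ψ.IsNormalAt x ξ) (u : MinkowskiSpace) :
    minkowski ξ (ψ.normalPart x u) = minkowski ξ u := by
  rw [normalPart, map_sub, hξ, sub_zero]

/-- A normal null vector `ξ` and a normal vector not orthogonal to `ξ` span the normal plane. -/
theorem IsNormalAt.exists_eq_add_of_null {ψ : SpacelikeSurface M} {x : M} {ξ ν η : MinkowskiSpace}
    (hξ : ψ.IsNormalAt x ξ) (hν : ψ.IsNormalAt x ν) (hη : ψ.IsNormalAt x η)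
    (hnull : minkowski ξ ξ = 0) (hne : minkowski ξ ν ≠ 0) :
    ∃ a b : ℝ, a • ξ + b • ν = η := by
  let W : Submodule ℝ MinkowskiSpace :=
    LinearMap.range (ψ.differential x : TangentSpace (𝓡 2) x →ₗ[ℝ] MinkowskiSpace)
  let N := minkowski.orthogonal W
  have mem {ζ : MinkowskiSpace} (hζ : ψ.IsNormalAt x ζ) : ζ ∈ N := by
    rintro _ ⟨v, rfl⟩
    exact (minkowski_symm _ _).trans (hζ v)
  have hN : Module.finrank ℝ N = 2 := by
    have hW : Module.finrank ℝ W = 2 :=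
      (LinearMap.finrank_range_of_inj (ψ.differential_injective x)).trans (finrank_tangentSpace x)
    rw [LinearMap.BilinForm.finrank_orthogonal minkowski_nondegenerate, hW]
    simp
  have hind : LinearIndependent ℝ ![ξ, ν] := by
    rw [LinearIndependent.pair_iff]
    intro s t hst
    -- Pairing the relation with `ξ` kills the `ξ` term, since `ξ` is null, and leaves `t ⟨ξ, ν⟩ =
    -- 0`.
    have ht : t = 0 := by
      have h := congrArg (minkowski ξ) hst
      simpa [hnull, hne] using h
    have hξ0 : ξ ≠ 0 := fun h ↦ hne (by simp [h])
    refine ⟨?_, ht⟩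
    simpa [ht, hξ0] using hst
  have hspan : Submodule.span ℝ {ξ, ν} = N := by
    refine Submodule.eq_of_le_of_finrank_eq ?_ ?_
    · rw [Submodule.span_le]
      rintro ζ (rfl | rfl)
      exacts [mem hξ, mem hν]
    · rw [hN, ← Matrix.range_cons_cons_empty ξ ν ![], finrank_span_eq_card hind, Fintype.card_fin]
  have h := mem hη
  rwa [← hspan, Submodule.mem_span_pair] at h

/-! ### The position vector from the vertex of the cone -/

section Position

variable {ψ : SpacelikeSurface M} {p : MinkowskiSpace}

theorem mvfderiv_sub_const (x : M) (v : TangentSpace (𝓡 2) x) :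
    mvfderiv (𝓡 2) (fun y ↦ ψ y - p) x v = ψ.differential x v := by
  have h := mvfderiv_sub (ψ.mdifferentiable x) (mdifferentiableAt_const (c := p))
  rw [mvfderiv_const, sub_zero] at h
  exact congrArg (fun L ↦ L v) h

theorem mdifferentiableAt_sub_const (x : M) :
    MDifferentiableAt (𝓡 2) 𝓘(ℝ, MinkowskiSpace) (fun y ↦ ψ y - p) x :=
  (ψ.mdifferentiable x).sub mdifferentiableAt_const

theorem isNormalAt_position (hnull : ∀ x, minkowski (ψ x - p) (ψ x - p) = 0) (x : M) :
    ψ.IsNormalAt x (ψ x - p) := by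
  intro v
  have h := mvfderiv_minkowski (mdifferentiableAt_sub_const (ψ := ψ) (p := p) x)
    (mdifferentiableAt_sub_const (ψ := ψ) (p := p) x) v
  simp only [hnull, mvfderiv_const, mvfderiv_sub_const] at h
  rw [minkowski_symm (ψ.differential x v)] at h
  simp only [zero_apply] at h
  linarith

end Position

variable [IsManifold (𝓡 2) ∞ M]

/-! ### Differentiability of the gradient -/

theorem mdifferentiableAt_metric (ψ : SpacelikeSurface M) {Y Z : Π x : M, TangentSpace (𝓡 2) x}
    {x : M} (hY : DifferentiableFieldAt Y x) (hZ : DifferentiableFieldAt Z x) :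
    MDifferentiableAt (𝓡 2) 𝓘(ℝ, ℝ) (fun y ↦ ψ.metric y (Y y) (Z y)) x :=
  mdifferentiableAt_minkowski (ψ.mdifferentiableAt_pushforward hY)
    (ψ.mdifferentiableAt_pushforward hZ)

/-- A vector field is differentiable at `x` as soon as its inner products with vector fields
differentiable at `x` are. -/
theorem differentiableFieldAt_of_metric (ψ : SpacelikeSurface M)
    {G : Π x : M, TangentSpace (𝓡 2) x} {x : M}
    (hG : ∀ Y : Π x : M, TangentSpace (𝓡 2) x, DifferentiableFieldAt Y x →
      MDifferentiableAt (𝓡 2) 𝓘(ℝ, ℝ) (fun y ↦ ψ.metric y (G y) (Y y)) x) :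
    DifferentiableFieldAt G x := by
  let e := trivializationAt (EuclideanSpace ℝ (Fin 2)) (TangentSpace (𝓡 2) : M → Type _) x
  let b := (EuclideanSpace.basisFun (Fin 2) ℝ).toBasis
  have hx : x ∈ e.baseSet := mem_baseSet_trivializationAt _ _ x
  let X (i : Fin 2) : Π x : M, TangentSpace (𝓡 2) x := e.localFrame b i
  have hX (i : Fin 2) : DifferentiableFieldAt (X i) x :=
    (contMDiffAt_localFrame_of_mem 1 e b i hx).mdifferentiableAt one_ne_zero
  let g (i j : Fin 2) (y : M) : ℝ := ψ.metric y (X i y) (X j y)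
  let h (i : Fin 2) (y : M) : ℝ := ψ.metric y (G y) (X i y)
  -- The Gram determinant of the local frame, nonzero because the metric is nondegenerate.
  let d (y : M) : ℝ := g 0 0 y * g 1 1 y - g 0 1 y * g 1 0 y
  have hg (i j) : MDifferentiableAt (𝓡 2) 𝓘(ℝ, ℝ) (g i j) x :=
    ψ.mdifferentiableAt_metric (hX i) (hX j)
  have hh (i) : MDifferentiableAt (𝓡 2) 𝓘(ℝ, ℝ) (h i) x := hG _ (hX i)
  have hd : MDifferentiableAt (𝓡 2) 𝓘(ℝ, ℝ) d x :=
    ((hg 0 0).mul (hg 1 1)).sub ((hg 0 1).mul (hg 1 0))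
  have hbasis {y : M} (hy : y ∈ e.baseSet) (i : Fin 2) : e.basisAt b hy i = X i y :=
    (e.localFrame_apply_of_mem_baseSet b hy).symm
  have hd0 {y : M} (hy : y ∈ e.baseSet) : d y ≠ 0 := by
    have := (LinearMap.BilinForm.nondegenerate_iff_det_ne_zero (e.basisAt b hy)).1
      (ψ.metric_nondegenerate y)
    simpa [Matrix.det_fin_two, LinearMap.BilinForm.toMatrix_apply, hbasis hy] using this
  -- Cramer's rule for the coefficients of `G` in the frame: they are rational in the differentiable
  -- functions `g` and `h`.
  let a₀ (y : M) : ℝ := (h 0 y * g 1 1 y - h 1 y * g 1 0 y) / d y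
  let a₁ (y : M) : ℝ := (h 1 y * g 0 0 y - h 0 y * g 0 1 y) / d y
  have ha₀ : MDifferentiableAt (𝓡 2) 𝓘(ℝ, ℝ) a₀ x :=
    (((hh 0).mul (hg 1 1)).sub ((hh 1).mul (hg 1 0))).div hd (hd0 hx)
  have ha₁ : MDifferentiableAt (𝓡 2) 𝓘(ℝ, ℝ) a₁ x :=
    (((hh 1).mul (hg 0 0)).sub ((hh 0).mul (hg 0 1))).div hd (hd0 hx)
  have hZ : DifferentiableFieldAt (fun y ↦ a₀ y • X 0 y + a₁ y • X 1 y) x :=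
    mdifferentiableAt_add_section (ha₀.smul_section (hX 0)) (ha₁.smul_section (hX 1))
  refine hZ.congr_of_eventuallyEq ?_
  filter_upwards [e.open_baseSet.mem_nhds hx] with y hy
  suffices G y = a₀ y • X 0 y + a₁ y • X 1 y by rw [this]
  refine sub_eq_zero.mp ((ψ.metric_nondegenerate y).1 _ fun w ↦ ?_)
  suffices ψ.metric y (G y - (a₀ y • X 0 y + a₁ y • X 1 y)) = 0 by rw [this]; rfl
  refine (e.basisAt b hy).ext fun i ↦ ?_
  have hdy := hd0 hy
  have key : h i y - (a₀ y * g 0 i y + a₁ y * g 1 i y) = 0 := by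
    simp only [a₀, a₁]
    rw [div_mul_eq_mul_div, div_mul_eq_mul_div, ← add_div, sub_eq_zero, eq_div_iff hdy]
    fin_cases i <;> simp only [d, Fin.zero_eta, Fin.mk_one] <;> ring
  rw [hbasis hy]
  simpa using key

/-- Needed because metric compatibility is available only for differentiable fields. The inner
product of the gradient with `Y` is the zeroth coordinate of `ψ_* Y`. -/
theorem differentiableFieldAt_gradient (ψ : SpacelikeSurface M) (x : M) :
    DifferentiableFieldAt (ψ.gradient fun y ↦ ψ y 0) x := by
  refine ψ.differentiableFieldAt_of_metric fun Y hY ↦ ?_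
  have h := mdifferentiableAt_minkowski (ψ.mdifferentiableAt_pushforward hY)
    (mdifferentiableAt_const (c := timeVector))
  refine h.congr_of_eventuallyEq (.of_forall fun y ↦ ?_)
  change ψ.metric y (ψ.gradient (fun y ↦ ψ y 0) y) (Y y) = minkowski (ψ.pushforward Y y) timeVector
  rw [metric_gradient, mvfderiv_apply_zero (ψ.mdifferentiable y), minkowski_timeVector]
  rfl

/-! ### Symmetry and normality of the second fundamental form -/

theorem secondFundamentalForm_eq_extend (ψ : SpacelikeSurface M) (x : M)
    (v w : TangentSpace (𝓡 2) x) :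
    ψ.secondFundamentalForm x v w =
      mvfderiv (𝓡 2) (ψ.pushforward (extend (EuclideanSpace ℝ (Fin 2)) w)) x v -
        ψ.differential x (ψ.leviCivita (extend (EuclideanSpace ℝ (Fin 2)) w) x v) := by
  have h := ψ.secondFundamentalForm_apply (X := extend (EuclideanSpace ℝ (Fin 2)) v)
    (mdifferentiableAt_extend (𝓡 2) (EuclideanSpace ℝ (Fin 2)) w)
  simpa using h

/-- The flat derivative and `∇` are both torsion-free, so their antisymmetric parts are the same
vector `ψ_* [V, W]` and cancel. -/
theorem secondFundamentalForm_symm (ψ : SpacelikeSurface M) (x : M)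
    (v w : TangentSpace (𝓡 2) x) :
    ψ.secondFundamentalForm x v w = ψ.secondFundamentalForm x w v := by
  have hv := mdifferentiableAt_extend (𝓡 2) (EuclideanSpace ℝ (Fin 2)) v
  have hw := mdifferentiableAt_extend (𝓡 2) (EuclideanSpace ℝ (Fin 2)) w
  have h1 := ψ.differential_mlieBracket hv hw
  rw [← (ψ.leviCivita.torsion_eq_zero_iff.1 ψ.isLeviCivita_leviCivita.torsion_eq_zero) hv hw,
    map_sub, extend_apply_self, extend_apply_self] at h1
  rw [secondFundamentalForm_eq_extend, secondFundamentalForm_eq_extend, sub_eq_sub_iff_sub_eq_sub,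
    ← h1]

/-- The flat derivative and `∇` both obey the product rule for `⟨ψ_* V, ψ_* W⟩`; subtracting the two
rules leaves this identity. -/
theorem minkowski_secondFundamentalForm_antisymm (ψ : SpacelikeSurface M) (x : M)
    (u v w : TangentSpace (𝓡 2) x) :
    minkowski (ψ.secondFundamentalForm x u v) (ψ.differential x w) =
      -minkowski (ψ.secondFundamentalForm x u w) (ψ.differential x v) := by
  have hv := mdifferentiableAt_extend (𝓡 2) (EuclideanSpace ℝ (Fin 2)) v
  have hw := mdifferentiableAt_extend (𝓡 2) (EuclideanSpace ℝ (Fin 2)) w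
  have h1 := ψ.isLeviCivita_leviCivita.metric_compatible x _ _ hv hw u
  have h2 := mvfderiv_minkowski (ψ.mdifferentiableAt_pushforward hv)
    (ψ.mdifferentiableAt_pushforward hw) u
  have h3 := h1.symm.trans h2
  simp only [metric_apply, pushforward, extend_apply_self] at h3
  rw [secondFundamentalForm_eq_extend, secondFundamentalForm_eq_extend, map_sub, map_sub,
    LinearMap.sub_apply, LinearMap.sub_apply,
    minkowski_symm (mvfderiv (𝓡 2) (ψ.pushforward (extend _ w)) x u),
    minkowski_symm (ψ.differential x (ψ.leviCivita (extend _ w) x u))]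
  linarith

/-- The second fundamental form takes values in the normal plane. -/
theorem isNormalAt_secondFundamentalForm (ψ : SpacelikeSurface M) (x : M)
    (u v : TangentSpace (𝓡 2) x) : ψ.IsNormalAt x (ψ.secondFundamentalForm x u v) := by
  intro w
  -- The form `T(u, v, w) = ⟨II(u, v), ψ_* w⟩` is symmetric in `u, v` and antisymmetric in `v, w`.
  -- Alternating the two symmetries gives `T = -T`, as in the uniqueness of the Levi-Civita
  -- connection.
  have h1 := ψ.minkowski_secondFundamentalForm_antisymm x u v w
  have h2 := ψ.minkowski_secondFundamentalForm_antisymm x w u v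
  have h3 := ψ.minkowski_secondFundamentalForm_antisymm x v w u
  rw [ψ.secondFundamentalForm_symm x u w] at h1
  rw [ψ.secondFundamentalForm_symm x w v] at h2
  rw [ψ.secondFundamentalForm_symm x v u] at h3
  linarith

/-! ### The Hessian and the position vector in terms of shape operators -/

theorem metric_hessian (ψ : SpacelikeSurface M) (x : M) (v w : TangentSpace (𝓡 2) x) :
    ψ.metric x (ψ.hessian (fun y ↦ ψ y 0) x v) w = ψ.secondFundamentalForm x v w 0 := by
  have hw := mdifferentiableAt_extend (𝓡 2) (EuclideanSpace ℝ (Fin 2)) w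
  -- Differentiate `⟨∇ψ₀, W⟩ = (ψ_* W)₀` along `v`. The term `⟨∇ψ₀, ∇_v W⟩` is `(ψ_* ∇_v W)₀`, so
  -- what remains is the zeroth coordinate of the Gauss formula.
  have h1 := ψ.isLeviCivita_leviCivita.metric_compatible x _ _
    (ψ.differentiableFieldAt_gradient x) hw v
  have h2 : (fun y ↦ ψ.metric y (ψ.gradient (fun y ↦ ψ y 0) y)
      (extend (EuclideanSpace ℝ (Fin 2)) w y)) =
      fun y ↦ ψ.pushforward (extend (EuclideanSpace ℝ (Fin 2)) w) y 0 := by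
    ext y
    rw [metric_gradient, mvfderiv_apply_zero (ψ.mdifferentiable y)]
    rfl
  rw [h2, mvfderiv_apply_zero (ψ.mdifferentiableAt_pushforward hw), metric_gradient,
    mvfderiv_apply_zero (ψ.mdifferentiable x), extend_apply_self] at h1
  rw [secondFundamentalForm_eq_extend, Pi.sub_apply, h1]
  exact (add_sub_cancel_right _ _).symm

theorem hessian_eq_shapeOperator (ψ : SpacelikeSurface M) (x : M) :
    ψ.hessian (fun y ↦ ψ y 0) x = ψ.shapeOperator x (ψ.normalPart x timeVector) := by
  ext1 v
  refine sub_eq_zero.mp ((ψ.metric_nondegenerate x).1 _ fun w ↦ ?_)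
  rw [map_sub, LinearMap.sub_apply, metric_hessian, metric_shapeOperator,
    (ψ.isNormalAt_secondFundamentalForm x v w).minkowski_normalPart, minkowski_timeVector, sub_self]

theorem shapeOperator_add_smul (ψ : SpacelikeSurface M) (x : M) (a b : ℝ) (ξ ν : MinkowskiSpace) :
    ψ.shapeOperator x (a • ξ + b • ν) = a • ψ.shapeOperator x ξ + b • ψ.shapeOperator x ν := by
  ext1 v
  refine sub_eq_zero.mp ((ψ.metric_nondegenerate x).1 _ fun w ↦ ?_)
  simp [metric_shapeOperator]

/-- Along a surface in a lightcone, the position vector from the vertex has shape operator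
`-I`. -/
theorem shapeOperator_position {ψ : SpacelikeSurface M} {p : MinkowskiSpace}
    (hnull : ∀ x, minkowski (ψ x - p) (ψ x - p) = 0) (x : M) :
    ψ.shapeOperator x (ψ x - p) = (-1 : ℝ) • LinearMap.id := by
  ext1 v
  refine sub_eq_zero.mp ((ψ.metric_nondegenerate x).1 _ fun w ↦ ?_)
  have hw := mdifferentiableAt_extend (𝓡 2) (EuclideanSpace ℝ (Fin 2)) w
  -- Differentiating `⟨ψ - p, ψ_* W⟩ = 0` along `v` gives `⟨v, w⟩ + ⟨ψ - p, D_v(ψ_* W)⟩ = 0`. The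
  -- tangential term `ψ_*(∇_v W)` is orthogonal to `ψ - p`, so `D_v(ψ_* W)` may be replaced by
  -- `II(v, w)`.
  have h := mvfderiv_minkowski (mdifferentiableAt_sub_const (ψ := ψ) (p := p) x)
    (ψ.mdifferentiableAt_pushforward hw) v
  have h0 : (fun y ↦ minkowski (ψ y - p)
      (ψ.pushforward (extend (EuclideanSpace ℝ (Fin 2)) w) y)) = fun _ ↦ 0 :=
    funext fun y ↦ isNormalAt_position hnull y _
  rw [h0, mvfderiv_const, mvfderiv_sub_const, pushforward, extend_apply_self,
    ← metric_apply] at h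
  rw [map_sub, LinearMap.sub_apply, metric_shapeOperator, minkowski_symm,
    secondFundamentalForm_eq_extend, map_sub, isNormalAt_position hnull x]
  simp only [zero_apply] at h
  simp only [LinearMap.smul_apply, LinearMap.id_apply, map_smul, smul_eq_mul]
  linarith

end SpacelikeSurface

/-! ### The characterization of totally umbilical surfaces -/

open SpacelikeSurface in
theorem corollary3p4 {M : Type*} [TopologicalSpace M]
    [ChartedSpace (EuclideanSpace ℝ (Fin 2)) M] [IsManifold (𝓡 2) ∞ M]
    (ψ : SpacelikeSurface M) (hψ : ψ.FactorsThroughLightcone) :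
    ψ.IsTotallyUmbilical ↔
      ∀ x : M, ψ.hessian (fun y ↦ ψ y 0) x =
        ((1 / 2 : ℝ) * ψ.laplacian (fun y ↦ ψ y 0) x) • LinearMap.id := by
  obtain ⟨p, hp⟩ := hψ
  -- Future and past cones are treated alike: only nullity and a nonzero time coordinate matter, not
  -- its sign.
  have hcone (x : M) : minkowski (ψ x - p) (ψ x - p) = 0 ∧ (ψ x - p) 0 ≠ 0 := by
    rcases hp with hp | hp
    · exact ⟨(hp x).1, (hp x).2.ne'⟩
    · rw [← neg_sub p (ψ x)]
      refine ⟨by rw [LinearMap.map_neg₂, map_neg, neg_neg]; exact (hp x).1, ?_⟩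
      rw [Pi.neg_apply]
      exact neg_ne_zero.2 (hp x).2.ne'
  have hnull (x : M) := (hcone x).1
  constructor
  · intro hu x
    obtain ⟨c, hc⟩ := hu x _ (ψ.isNormalAt_normalPart x timeVector)
    rw [← hessian_eq_shapeOperator] at hc
    have htr : ψ.laplacian (fun y ↦ ψ y 0) x = c * 2 := by
      rw [laplacian, hc, map_smul, LinearMap.trace_id, finrank_tangentSpace]
      simp
    rw [htr, hc]
    congr 1
    ring
  · intro hh x η hη
    have hξ := isNormalAt_position hnull x
    have hν := ψ.isNormalAt_normalPart x timeVector
    have hne : minkowski (ψ x - p) (ψ.normalPart x timeVector) ≠ 0 := by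
      rw [hξ.minkowski_normalPart, minkowski_timeVector]
      exact (hcone x).2
    obtain ⟨a, b, rfl⟩ := hξ.exists_eq_add_of_null hν hη (hnull x) hne
    -- For `η = a ξ + b ν`, the factor combines `A_ξ = -I` with `A_ν = ∇²ψ₀ = ½ Δψ₀ I`.
    refine ⟨a * -1 + b * ((1 / 2 : ℝ) * ψ.laplacian (fun y ↦ ψ y 0) x), ?_⟩
    rw [shapeOperator_add_smul, shapeOperator_position hnull, ← hessian_eq_shapeOperator,
      hh x, smul_smul, smul_smul, add_smul]
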